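/- Let $(\Sigma,\sigma)$ be a finite-dimensional real symplectic vector space and let $L(\Sigma)$ be the set of its Lagrangian planes, that is, of the subspaces of dimension $\frac12\dim\Sigma$ on which $\sigma$ vanishes. For $\Lambda_1,\Pi,\Lambda_2\in L(\Sigma)$ let $q$ be the (well-defined) quadratic form $$q(\lambda)=\sigma(\lambda_1,\lambda_2),\qquad \lambda=\lambda_1+\lambda_2,\quad \lambda_i\in\Lambda_i,$$ on $\big((\Lambda_1+\Lambda_2)\cap\Pi\big)/(\Lambda_1\cap\Pi\cap\Lambda_2)$, and put $$\operatorname{ind}_\Pi(\Lambda_1,\Lambda_2)=\operatorname{ind}^+q+\tfrac12\dim\ker q,$$ where $\operatorname{ind}^+ q$ is the maximal dimension of a subspace on which $q$ is positive definite. Let $T>0$. For an arbitrary (not necessarily continuous) curve $\Lambda:[0,T]\to L(\Sigma)$ and a partition $D=\{0=t_0<t_1<\dots<t_N=T\}$ put $$\operatorname{ind}^D_\Pi\Lambda=\sum_{i=0}^{N-1}\operatorname{ind}_\Pi(\Lambda(t_i),\Lambda(t_{i+1})),\qquad \operatorname{ind}_\Pi\Lambda=\sup_D\operatorname{ind}^D_\Pi\Lambda\in[0,+\infty].$$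 The curve is called monotone increasing if $\operatorname{ind}_{\Pi_0}\Lambda<+\infty$ for some $\Pi_0\in L(\Sigma)$. If $\Lambda$ is monotone increasing and closed, i.e. $\Lambda(0)=\Lambda(T)$, then $$\operatorname{ind}_\Pi\Lambda=\operatorname{ind}_\Delta\Lambda\qquad\text{for all }\Pi,\Delta\in L(\Sigma)$$ (in particular, $\operatorname{ind}_\Pi\Lambda$ is finite for every $\Pi\in L(\Sigma)$). -/

import Mathlib

namespace Symp

variable {V : Type*} [AddCommGroup V] [Module ℝ V]

/-- A symplectic form: an alternating non-degenerate bilinear form. -/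
structure IsSymplectic (σ : LinearMap.BilinForm ℝ V) : Prop where
  alt : σ.IsAlt
  nondegenerate : σ.Nondegenerate

/-- Lagrangian planes: isotropic subspaces of half the dimension of the space. -/
@[ext]
structure LagrangianPlane (σ : LinearMap.BilinForm ℝ V) where
  carrier : Submodule ℝ V
  isotropic : ∀ x ∈ carrier, ∀ y ∈ carrier, σ x y = 0
  two_mul_finrank : 2 * Module.finrank ℝ carrier = Module.finrank ℝ V

variable {σ : LinearMap.BilinForm ℝ V}

/-- Every vector of `A + B` is `a + b` with `a ∈ A`, `b ∈ B`, and both can be chosen linearly. -/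
theorem exists_splitting (A B : Submodule ℝ V) :
    ∃ s : ↥(A ⊔ B) →ₗ[ℝ] V × V,
      ∀ x, (s x).1 ∈ A ∧ (s x).2 ∈ B ∧ (s x).1 + (s x).2 = (x : V) := by
  have hmem : ∀ p : A × B, (p.1 : V) + (p.2 : V) ∈ A ⊔ B := fun p =>
    Submodule.add_mem_sup p.1.2 p.2.2
  let f : (A × B) →ₗ[ℝ] ↥(A ⊔ B) :=
    LinearMap.codRestrict (A ⊔ B) (A.subtype.coprod B.subtype) hmem
  have hf : LinearMap.range f = ⊤ := by
    rw [LinearMap.range_eq_top]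
    rintro ⟨x, hx⟩
    obtain ⟨a, ha, b, hb, rfl⟩ := Submodule.mem_sup.1 hx
    exact ⟨(⟨a, ha⟩, ⟨b, hb⟩), rfl⟩
  obtain ⟨g, hg⟩ := f.exists_rightInverse_of_surjective hf
  refine ⟨(A.subtype.prodMap B.subtype) ∘ₗ g, fun x => ⟨(g x).1.2, (g x).2.2, ?_⟩⟩
  exact congrArg Subtype.val (LinearMap.congr_fun hg x)

/-- The space `(Λ₁ + Λ₂) ∩ Γ`. -/
def formSpace (Λ₁ Γ Λ₂ : LagrangianPlane σ) : Submodule ℝ V :=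
  (Λ₁.carrier ⊔ Λ₂.carrier) ⊓ Γ.carrier

/-- `Λ₁ ∩ Γ ∩ Λ₂`, as a subspace of `(Λ₁ + Λ₂) ∩ Γ`. -/
def tripleInter (Λ₁ Γ Λ₂ : LagrangianPlane σ) : Submodule ℝ (formSpace Λ₁ Γ Λ₂) :=
  (Λ₁.carrier ⊓ Γ.carrier ⊓ Λ₂.carrier).comap (formSpace Λ₁ Γ Λ₂).subtype

theorem formSpace_splitting (Λ₁ Γ Λ₂ : LagrangianPlane σ) :
    ∃ s : formSpace Λ₁ Γ Λ₂ →ₗ[ℝ] V × V,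
      ∀ x, (s x).1 ∈ Λ₁.carrier ∧ (s x).2 ∈ Λ₂.carrier ∧ (s x).1 + (s x).2 = (x : V) := by
  obtain ⟨s, hs⟩ := exists_splitting Λ₁.carrier Λ₂.carrier
  have hle : formSpace Λ₁ Γ Λ₂ ≤ Λ₁.carrier ⊔ Λ₂.carrier := inf_le_left
  exact ⟨s ∘ₗ Submodule.inclusion hle, fun x => hs (Submodule.inclusion hle x)⟩

/-- The quadratic form `q(x) = σ(x₁, x₂)`, `x = x₁ + x₂`, `xᵢ ∈ Λᵢ`, on `(Λ₁ + Λ₂) ∩ Γ`.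
It is computed from one choice of the decompositions; `preForm_eq` says that the value is the same
for every decomposition. -/
noncomputable def preForm (Λ₁ Γ Λ₂ : LagrangianPlane σ) :
    QuadraticForm ℝ (formSpace Λ₁ Γ Λ₂) :=
  LinearMap.BilinMap.toQuadraticMap
    (σ.compl₁₂ (LinearMap.fst ℝ V V ∘ₗ (formSpace_splitting Λ₁ Γ Λ₂).choose)
      (LinearMap.snd ℝ V V ∘ₗ (formSpace_splitting Λ₁ Γ Λ₂).choose))

theorem preForm_eq (Λ₁ Γ Λ₂ : LagrangianPlane σ) (x : formSpace Λ₁ Γ Λ₂) {a b : V}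
    (ha : a ∈ Λ₁.carrier) (hb : b ∈ Λ₂.carrier) (hab : a + b = (x : V)) :
    preForm Λ₁ Γ Λ₂ x = σ a b := by
  obtain ⟨h1, h2, h3⟩ := (formSpace_splitting Λ₁ Γ Λ₂).choose_spec x
  change σ ((formSpace_splitting Λ₁ Γ Λ₂).choose x).1
    ((formSpace_splitting Λ₁ Γ Λ₂).choose x).2 = σ a b
  set u := ((formSpace_splitting Λ₁ Γ Λ₂).choose x).1
  set v := ((formSpace_splitting Λ₁ Γ Λ₂).choose x).2
  have hx : u + v = a + b := h3.trans hab.symm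
  have hd : u - a = b - v := by
    rw [sub_eq_sub_iff_add_eq_add, hx, add_comm]
  have e1 : σ u (b - v) = 0 := by
    rw [← hd]; exact Λ₁.isotropic _ h1 _ (sub_mem h1 ha)
  have e2 : σ (u - a) b = 0 := by
    rw [hd]; exact Λ₂.isotropic _ (sub_mem hb h2) _ hb
  rw [map_sub, sub_eq_zero] at e1
  rw [map_sub, LinearMap.sub_apply, sub_eq_zero] at e2
  rw [← e1, e2]

theorem tripleInter_le_radical (Λ₁ Γ Λ₂ : LagrangianPlane σ) :
    tripleInter Λ₁ Γ Λ₂ ≤ (preForm Λ₁ Γ Λ₂).radical := by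
  intro x hx
  have hx1 : (x : V) ∈ Λ₁.carrier := hx.1.1
  have hx2 : (x : V) ∈ Λ₂.carrier := hx.2
  rw [QuadraticMap.mem_radical_iff']
  constructor
  · rw [preForm_eq Λ₁ Γ Λ₂ x hx1 (zero_mem _) (add_zero _), map_zero]
  · intro y
    obtain ⟨a, ha, b, hb, hab⟩ := Submodule.mem_sup.1 y.2.1
    rw [preForm_eq Λ₁ Γ Λ₂ y ha hb hab,
      preForm_eq Λ₁ Γ Λ₂ (x + y) (add_mem hx1 ha) hb
        (by rw [add_assoc, hab]; rfl),
      map_add, LinearMap.add_apply]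
    have : σ (x : V) b = 0 := Λ₂.isotropic _ hx2 _ hb
    rw [this, zero_add]

/-- The quadratic form `q(x) = σ(x₁, x₂)` on `((Λ₁ + Λ₂) ∩ Γ) / (Λ₁ ∩ Γ ∩ Λ₂)`. -/
noncomputable def form (Λ₁ Γ Λ₂ : LagrangianPlane σ) :
    QuadraticForm ℝ (formSpace Λ₁ Γ Λ₂ ⧸ tripleInter Λ₁ Γ Λ₂) :=
  (preForm Λ₁ Γ Λ₂).lift (tripleInter Λ₁ Γ Λ₂) (tripleInter_le_radical Λ₁ Γ Λ₂)

/-- The positive Maslov index `ind_Γ(Λ₁, Λ₂) = ind⁺ q + (1/2) dim ker q`. -/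
noncomputable def posMaslovIndex (Γ Λ₁ Λ₂ : LagrangianPlane σ) : ℝ :=
  (sigPos (form Λ₁ Γ Λ₂) : ℝ) + (1 / 2 : ℝ) * (Module.finrank ℝ (form Λ₁ Γ Λ₂).radical : ℝ)

/-- A partition `0 = t₀ < t₁ < ⋯ < t_N = T` of `[0, T]`. -/
structure IntervalPartition (T : ℝ) where
  N : ℕ
  t : Fin (N + 1) → Set.Icc (0 : ℝ) T
  strictMono : StrictMono t
  first : (t 0 : ℝ) = 0
  last : (t (Fin.last N) : ℝ) = T

/-- `ind_Γ^D Λ = ∑_{i=0}^{N-1} ind_Γ(Λ(t_i), Λ(t_{i+1}))`. -/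
noncomputable def partitionIndex {T : ℝ} (Γ : LagrangianPlane σ)
    (Λ : Set.Icc (0 : ℝ) T → LagrangianPlane σ) (D : IntervalPartition T) : ℝ :=
  ∑ i : Fin D.N, posMaslovIndex Γ (Λ (D.t i.castSucc)) (Λ (D.t i.succ))

/-- `ind_Γ Λ = sup_D ind_Γ^D Λ`, a supremum in the extended reals. -/
noncomputable def curveIndex {T : ℝ} (Γ : LagrangianPlane σ)
    (Λ : Set.Icc (0 : ℝ) T → LagrangianPlane σ) : EReal :=
  ⨆ D : IntervalPartition T, ((partitionIndex Γ Λ D : ℝ) : EReal)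

/-- `Λ` is monotone increasing if `ind_Γ Λ < +∞` for some Lagrangian plane `Γ`. No continuity of
`Λ` is required. -/
def IsMonotoneIncreasing {T : ℝ} (Λ : Set.Icc (0 : ℝ) T → LagrangianPlane σ) : Prop :=
  ∃ Γ : LagrangianPlane σ, curveIndex Γ Λ < ⊤

end Symp

/-!
Let `τ(a, b, c)` be the signature of the `σ`-area on the space of closed triangles with sides in
`a`, `b`, `c`. The map `(x, y, z) ↦ x + y = -z` shows that the form `q` of `a`, `b` on `Γ` has
signature `τ(a, b, Γ)`, and a dimension count then gives
`ind_Γ(a, b) = τ(a, b, Γ) / 2 + dim V / 4 - dim (a ∩ b) / 2`.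

In the space of closed quadrilaterals with sides in `a`, `b`, `c`, `d`, the sums of a triangle with
sides in `a`, `b`, `c` and a triangle with sides in `c`, `d`, `a` form the orthogonal complement of
the flat quadrilaterals `(u, 0, -u, 0)`, `u ∈ a ∩ c`, on which the area vanishes. Restricting to
this complement preserves the signature, so the area of quadrilaterals has signature
`τ(a, b, c) + τ(c, d, a)`. Counting the sides from the second one gives `τ(b, c, d) + τ(d, a, b)`
for the same signature. This cocycle relation turns into
`ind_Γ(a, b) - ind_Δ(a, b) = (τ(b, Γ, Δ) - τ(a, Γ, Δ)) / 2`, which telescopes along a partition: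
replacing `Γ` by `Δ` changes the index by an amount that depends only on the end points.
-/

namespace Symp

open Module QuadraticMap QuadraticForm

section Signature

variable {𝕜 U M M' : Type*} [Field 𝕜]
  [AddCommGroup U] [Module 𝕜 U] [AddCommGroup M] [Module 𝕜 M] [AddCommGroup M'] [Module 𝕜 M']

theorem radical_restrict {R : Type*} [CommRing R] [Invertible (2 : R)] {E : Type*} [AddCommGroup E]
    [Module R E] (Q : QuadraticForm R E) (N : Submodule R E) :
    (Q.restrict N).radical = (LinearMap.BilinForm.orthogonal Q.polarBilin N).comap N.subtype := by
  ext x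
  rw [radical_eq_ker_polarBilin, LinearMap.mem_ker, LinearMap.ext_iff]
  exact ⟨fun h n hn => (polar_comm Q n x).trans (h ⟨n, hn⟩),
    fun h n => (polar_comm Q x n).trans (h n n.2)⟩

theorem finrank_add_finrank_radical_restrict [Invertible (2 : 𝕜)] [FiniteDimensional 𝕜 M]
    {Q : QuadraticForm 𝕜 M} {N : Submodule 𝕜 M}
    (hN : LinearMap.BilinForm.orthogonal Q.polarBilin N ≤ N) :
    finrank 𝕜 N + finrank 𝕜 (Q.restrict N).radical = finrank 𝕜 M + finrank 𝕜 Q.radical := by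
  have hrad : Q.radical ≤ LinearMap.BilinForm.orthogonal Q.polarBilin N := fun x hx n _ => by
    rw [radical_eq_ker_polarBilin] at hx
    exact (polar_comm Q n x).trans (LinearMap.congr_fun hx n)
  rw [radical_restrict, (Submodule.comapSubtypeEquivOfLe hN).finrank_eq,
    LinearMap.BilinForm.finrank_add_finrank_orthogonal', ← radical_eq_ker_polarBilin,
    inf_eq_right.2 (hrad.trans hN)]

theorem finrank_radical_add_le_finrank_radical_prod
    [FiniteDimensional 𝕜 M] [FiniteDimensional 𝕜 M']
    (Q : QuadraticForm 𝕜 M) (Q' : QuadraticForm 𝕜 M') :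
    finrank 𝕜 Q.radical + finrank 𝕜 Q'.radical ≤ finrank 𝕜 (Q.prod Q').radical := by
  have hinj : Function.Injective (Q.radical.subtype.prodMap Q'.radical.subtype) :=
    Q.radical.injective_subtype.prodMap Q'.radical.injective_subtype
  rw [← finrank_prod, ← LinearMap.finrank_range_of_inj hinj]
  refine Submodule.finrank_mono ?_
  rintro _ ⟨⟨⟨x, hx⟩, ⟨x', hx'⟩⟩, rfl⟩
  rw [mem_radical_iff'] at hx hx' ⊢
  exact ⟨by simp [hx.1, hx'.1], fun y => by simp [hx.2, hx'.2]⟩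

variable [LinearOrder 𝕜]

/-- The signature of a quadratic form over an ordered field: the positive index of inertia minus
the negative one. -/
noncomputable def signature (Q : QuadraticForm 𝕜 M) : ℤ :=
  (sigPos Q : ℤ) - sigNeg Q

theorem finrank_le_sigPos_of_isometry [FiniteDimensional 𝕜 M] {P : QuadraticForm 𝕜 U}
    {Q : QuadraticForm 𝕜 M} (hP : P.PosDef) (f : P →qᵢ Q) : finrank 𝕜 U ≤ sigPos Q := by
  have hker : LinearMap.ker f.toLinearMap = ⊥ := by
    refine LinearMap.ker_eq_bot'.2 fun x hx => hP.anisotropic x ?_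
    rw [← f.map_app, show f x = 0 from hx, map_zero]
  rw [← LinearMap.finrank_range_of_inj (LinearMap.ker_eq_bot.1 hker)]
  refine le_sigPos_of_posDef Q ?_
  rintro ⟨_, x, rfl⟩ hx
  have hx₀ : x ≠ 0 := fun h => hx (Subtype.ext (by simp [h]))
  exact (hP x hx₀).trans_eq (f.map_app x).symm

section IsometryInvariance

variable [FiniteDimensional 𝕜 M] [FiniteDimensional 𝕜 M']
  {Q : QuadraticForm 𝕜 M} {Q' : QuadraticForm 𝕜 M'}

theorem sigPos_le_of_isometry (f : Q →qᵢ Q') : sigPos Q ≤ sigPos Q' := by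
  obtain ⟨U, hU, hpos⟩ := exists_finrank_eq_sigPos_and_posDef Q
  rw [← hU]
  exact finrank_le_sigPos_of_isometry hpos ⟨f.toLinearMap.domRestrict U, fun x => f.map_app x⟩

theorem sigNeg_le_of_isometry (f : Q →qᵢ Q') : sigNeg Q ≤ sigNeg Q' :=
  sigPos_le_of_isometry (Q := -Q) (Q' := -Q')
    ⟨f.toLinearMap, fun x => congrArg Neg.neg (f.map_app x)⟩

theorem signature_eq_of_surjective (f : Q →qᵢ Q') (hf : Function.Surjective f) :
    signature Q = signature Q' := by
  obtain ⟨g, hg⟩ := f.toLinearMap.exists_rightInverse_of_surjective (LinearMap.range_eq_top.2 hf)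
  let g' : Q' →qᵢ Q := ⟨g, fun y => by
    rw [← f.map_app]
    exact congrArg Q' (LinearMap.congr_fun hg y)⟩
  rw [signature, signature, (sigPos_le_of_isometry f).antisymm (sigPos_le_of_isometry g'),
    (sigNeg_le_of_isometry f).antisymm (sigNeg_le_of_isometry g')]

end IsometryInvariance

section OrthogonalSum

variable [FiniteDimensional 𝕜 M] [FiniteDimensional 𝕜 M'] [IsStrictOrderedRing 𝕜]

theorem sigPos_add_sigPos_le_sigPos_prod (Q : QuadraticForm 𝕜 M) (Q' : QuadraticForm 𝕜 M') :
    sigPos Q + sigPos Q' ≤ sigPos (Q.prod Q') := by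
  obtain ⟨U, hU, hpos⟩ := exists_finrank_eq_sigPos_and_posDef Q
  obtain ⟨U', hU', hpos'⟩ := exists_finrank_eq_sigPos_and_posDef Q'
  rw [← hU, ← hU', ← finrank_prod]
  exact finrank_le_sigPos_of_isometry (hpos.prod hpos')
    ⟨U.subtype.prodMap U'.subtype, fun _ => rfl⟩

theorem sigNeg_add_sigNeg_le_sigNeg_prod (Q : QuadraticForm 𝕜 M) (Q' : QuadraticForm 𝕜 M') :
    sigNeg Q + sigNeg Q' ≤ sigNeg (Q.prod Q') := by
  have hneg : -(Q.prod Q') = (-Q).prod (-Q') := by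
    ext x
    simp [add_comm]
  simpa only [← sigPos_neg, hneg] using sigPos_add_sigPos_le_sigPos_prod (-Q) (-Q')

theorem signature_prod (Q : QuadraticForm 𝕜 M) (Q' : QuadraticForm 𝕜 M') :
    signature (Q.prod Q') = signature Q + signature Q' := by
  have hpos := sigPos_add_sigPos_le_sigPos_prod Q Q'
  have hneg := sigNeg_add_sigNeg_le_sigNeg_prod Q Q'
  have hrad := finrank_radical_add_le_finrank_radical_prod Q Q'
  have hdim := sigPos_add_sigNeg_add_radical (Q := Q)
  have hdim' := sigPos_add_sigNeg_add_radical (Q := Q')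
  have hdim_prod := sigPos_add_sigNeg_add_radical (Q := Q.prod Q')
  rw [finrank_prod] at hdim_prod
  simp only [signature]
  lia

end OrthogonalSum

section Reduction

variable [FiniteDimensional 𝕜 M]

theorem sigPos_add_finrank_le_sigPos_restrict_add (Q : QuadraticForm 𝕜 M) (N : Submodule 𝕜 M) :
    sigPos Q + finrank 𝕜 N ≤ sigPos (Q.restrict N) + finrank 𝕜 M := by
  obtain ⟨U, hU, hpos⟩ := exists_finrank_eq_sigPos_and_posDef Q
  have hinter : finrank 𝕜 ↥(U ⊓ N) ≤ sigPos (Q.restrict N) :=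
    finrank_le_sigPos_of_isometry (P := Q.restrict (U ⊓ N))
      (fun x hx => hpos ⟨x, x.2.1⟩ (by simpa using hx))
      ⟨Submodule.inclusion inf_le_right, fun _ => rfl⟩
  have hsum := Submodule.finrank_sup_add_finrank_inf_eq U N
  have hsup := (U ⊔ N).finrank_le
  lia

theorem sigNeg_add_finrank_le_sigNeg_restrict_add (Q : QuadraticForm 𝕜 M) (N : Submodule 𝕜 M) :
    sigNeg Q + finrank 𝕜 N ≤ sigNeg (Q.restrict N) + finrank 𝕜 M :=
  sigPos_add_finrank_le_sigPos_restrict_add (-Q) N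

variable [IsStrictOrderedRing 𝕜]

theorem signature_restrict_of_orthogonal_le {Q : QuadraticForm 𝕜 M} {N : Submodule 𝕜 M}
    (hN : LinearMap.BilinForm.orthogonal Q.polarBilin N ≤ N) :
    signature (Q.restrict N) = signature Q := by
  have : Invertible (2 : 𝕜) := invertibleOfNonzero two_ne_zero
  have hpos := sigPos_add_finrank_le_sigPos_restrict_add Q N
  have hneg := sigNeg_add_finrank_le_sigNeg_restrict_add Q N
  have hrad := finrank_add_finrank_radical_restrict hN
  have hdim := sigPos_add_sigNeg_add_radical (Q := Q)
  have hdimN := sigPos_add_sigNeg_add_radical (Q := Q.restrict N)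
  simp only [signature]
  lia

theorem signature_add_signature_of_orthogonal_range_sup_le {M₁ M₂ : Type*}
    [AddCommGroup M₁] [Module 𝕜 M₁] [FiniteDimensional 𝕜 M₁]
    [AddCommGroup M₂] [Module 𝕜 M₂] [FiniteDimensional 𝕜 M₂]
    {Q₁ : QuadraticForm 𝕜 M₁} {Q₂ : QuadraticForm 𝕜 M₂} {Q : QuadraticForm 𝕜 M}
    (f : Q₁ →qᵢ Q) (g : Q₂ →qᵢ Q) (hfg : ∀ x y, Q.IsOrtho (f x) (g y))
    (hN : LinearMap.BilinForm.orthogonal Q.polarBilin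
        (LinearMap.range f.toLinearMap ⊔ LinearMap.range g.toLinearMap) ≤
      LinearMap.range f.toLinearMap ⊔ LinearMap.range g.toLinearMap) :
    signature Q₁ + signature Q₂ = signature Q := by
  rw [← LinearMap.range_coprod] at hN
  rw [← signature_prod, ← signature_restrict_of_orthogonal_le hN]
  let glue : Q₁.prod Q₂ →qᵢ
      Q.restrict (LinearMap.range (f.toLinearMap.coprod g.toLinearMap)) :=
    ⟨(f.toLinearMap.coprod g.toLinearMap).rangeRestrict, fun x =>
      (hfg x.1 x.2).trans (congrArg₂ _ (f.map_app x.1) (g.map_app x.2))⟩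
  exact signature_eq_of_surjective glue
    (LinearMap.surjective_rangeRestrict (f.toLinearMap.coprod g.toLinearMap))

end Reduction

end Signature

section Orthogonal

theorem orthogonal_sup {R E : Type*} [CommRing R] [AddCommGroup E] [Module R E]
    (B : LinearMap.BilinForm R E) (N L : Submodule R E) :
    B.orthogonal (N ⊔ L) = B.orthogonal N ⊓ B.orthogonal L := by
  refine le_antisymm (le_inf (LinearMap.BilinForm.orthogonal_le le_sup_left)
    (LinearMap.BilinForm.orthogonal_le le_sup_right)) fun x hx y hy => ?_
  obtain ⟨n, hn, l, hl, rfl⟩ := Submodule.mem_sup.1 hy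
  change B (n + l) x = 0
  rw [map_add, LinearMap.add_apply, hx.1 n hn, hx.2 l hl, add_zero]

theorem orthogonal_inf {K E : Type*} [Field K] [AddCommGroup E] [Module K E]
    [FiniteDimensional K E] {B : LinearMap.BilinForm K E} (hB : B.Nondegenerate) (hB' : B.IsRefl)
    (N L : Submodule K E) : B.orthogonal (N ⊓ L) = B.orthogonal N ⊔ B.orthogonal L := by
  have h := orthogonal_sup B (B.orthogonal N) (B.orthogonal L)
  simp only [LinearMap.BilinForm.orthogonal_orthogonal hB hB'] at h
  rw [← h, LinearMap.BilinForm.orthogonal_orthogonal hB hB']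

end Orthogonal

section Polygons

section Areas

variable {R E : Type*} [CommRing R] [AddCommGroup E] [Module R E]

/-- Triangles with successive sides in `A`, `B`, `C`: the sides are oriented, so they add up to
zero. -/
def triangles (A B C : Submodule R E) : Submodule R (E × E × E) :=
  A.prod (B.prod C) ⊓ LinearMap.ker (LinearMap.id.coprod (LinearMap.id.coprod LinearMap.id))

/-- Quadrilaterals with successive sides in `A`, `B`, `C`, `D`, oriented as in `triangles`. -/
def quadrilaterals (A B C D : Submodule R E) : Submodule R (E × E × E × E) :=
  A.prod (B.prod (C.prod D)) ⊓
    LinearMap.ker (LinearMap.id.coprod (LinearMap.id.coprod (LinearMap.id.coprod LinearMap.id)))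

theorem mem_triangles {A B C : Submodule R E} {x y z : E} :
    (x, y, z) ∈ triangles A B C ↔ (x ∈ A ∧ y ∈ B ∧ z ∈ C) ∧ x + (y + z) = 0 :=
  Iff.rfl

theorem mem_quadrilaterals {A B C D : Submodule R E} {x y z w : E} :
    (x, y, z, w) ∈ quadrilaterals A B C D ↔
      (x ∈ A ∧ y ∈ B ∧ z ∈ C ∧ w ∈ D) ∧ x + (y + (z + w)) = 0 :=
  Iff.rfl

/-- Twice the area, measured by `σ`, of a triangle with prescribed side directions. -/
def triangleArea (σ : LinearMap.BilinForm R E) (A B C : Submodule R E) :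
    QuadraticForm R (triangles A B C) :=
  (LinearMap.BilinMap.toQuadraticMap (σ.compl₁₂ (LinearMap.fst R E (E × E))
    (LinearMap.fst R E E ∘ₗ LinearMap.snd R E (E × E)))).restrict _

/-- Twice the area, measured by `σ`, of a quadrilateral with prescribed side directions: the sum of
the two triangles cut off by the diagonal that joins the end of the second side to the start of the
first. -/
def quadrilateralArea (σ : LinearMap.BilinForm R E) (A B C D : Submodule R E) :
    QuadraticForm R (quadrilaterals A B C D) :=
  (LinearMap.BilinMap.toQuadraticMap
    (σ.compl₁₂ (LinearMap.fst R E (E × E × E))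
        (LinearMap.fst R E (E × E) ∘ₗ LinearMap.snd R E (E × E × E)) +
      σ.compl₁₂ (LinearMap.fst R E E ∘ₗ LinearMap.snd R E (E × E) ∘ₗ LinearMap.snd R E (E × E × E))
        (LinearMap.snd R E E ∘ₗ LinearMap.snd R E (E × E) ∘ₗ
          LinearMap.snd R E (E × E × E)))).restrict _

theorem quadrilateralArea_mk (σ : LinearMap.BilinForm R E) {A B C D : Submodule R E}
    {x y z w : E} (h : (x, y, z, w) ∈ quadrilaterals A B C D) :
    quadrilateralArea σ A B C D ⟨(x, y, z, w), h⟩ = σ x y + σ z w :=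
  rfl

section Halves

variable (σ : LinearMap.BilinForm R E) (A B C D : Submodule R E)

/-- The triangle `x, y, z` as a quadrilateral with vanishing last side. -/
def leftHalf : triangleArea σ A B C →qᵢ quadrilateralArea σ A B C D where
  toFun p := ⟨(p.1.1, p.1.2.1, p.1.2.2, 0), mem_quadrilaterals.2
    ⟨⟨p.2.1.1, p.2.1.2.1, p.2.1.2.2, zero_mem D⟩, by
      simpa only [add_zero] using (mem_triangles.1 p.2).2⟩⟩
  map_add' p q := by ext <;> simp
  map_smul' r p := by ext <;> simp
  map_app' p := by
    rw [quadrilateralArea_mk, map_zero, add_zero]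
    rfl

/-- The triangle `z, w, x` as a quadrilateral with vanishing second side. -/
def rightHalf : triangleArea σ C D A →qᵢ quadrilateralArea σ A B C D where
  toFun p := ⟨(p.1.2.2, 0, p.1.1, p.1.2.1), mem_quadrilaterals.2
    ⟨⟨p.2.1.2.2, zero_mem B, p.2.1.1, p.2.1.2.1⟩, by
      rw [zero_add, add_comm, add_assoc]
      exact (mem_triangles.1 p.2).2⟩⟩
  map_add' p q := by ext <;> simp
  map_smul' r p := by ext <;> simp
  map_app' p := by
    rw [quadrilateralArea_mk, map_zero, zero_add]
    rfl

end Halves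

theorem mem_range_leftHalf_sup_range_rightHalf (σ : LinearMap.BilinForm R E)
    {A B C D : Submodule R E} {x y z w : E} (h : (x, y, z, w) ∈ quadrilaterals A B C D)
    (hy : y ∈ A ⊔ C) :
    (⟨(x, y, z, w), h⟩ : quadrilaterals A B C D) ∈
      LinearMap.range (leftHalf σ A B C D).toLinearMap ⊔
        LinearMap.range (rightHalf σ A B C D).toLinearMap := by
  obtain ⟨⟨hx, hyB, hz, hw⟩, hsum⟩ := mem_quadrilaterals.1 h
  obtain ⟨a, ha, c, hc, hac⟩ := Submodule.mem_sup.1 hy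
  have hleft : (-a, y, -c) ∈ triangles A B C :=
    mem_triangles.2 ⟨⟨neg_mem ha, hyB, neg_mem hc⟩, by rw [← hac]; abel⟩
  have hright : (z + c, w, x + a) ∈ triangles C D A :=
    mem_triangles.2 ⟨⟨add_mem hz hc, hw, add_mem hx ha⟩, by rw [← hsum, ← hac]; abel⟩
  refine Submodule.mem_sup.2 ⟨_, ⟨⟨_, hleft⟩, rfl⟩, _, ⟨⟨_, hright⟩, rfl⟩, Subtype.ext ?_⟩
  simp [leftHalf, rightHalf]


variable {σ : LinearMap.BilinForm R E} {A B C D : Submodule R E}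

theorem isOrtho_leftHalf_rightHalf (hσ : σ.IsAlt) (hA : A ≤ σ.orthogonal A)
    (hC : C ≤ σ.orthogonal C) (p : triangles A B C) (q : triangles C D A) :
    (quadrilateralArea σ A B C D).IsOrtho (leftHalf σ A B C D p) (rightHalf σ A B C D q) := by
  obtain ⟨⟨x, y, z⟩, ⟨hx, -, hz⟩, hp⟩ := p
  obtain ⟨⟨z', w', x'⟩, ⟨hz', -, hx'⟩, hq⟩ := q
  change x + (y + z) = 0 at hp
  change z' + (w' + x') = 0 at hq
  have hy : σ x' y = -σ x' z := by
    have h := congrArg (σ x') hp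
    rwa [map_zero, map_add, map_add, hA hx x' hx', zero_add, ← eq_neg_iff_add_eq_zero] at h
  have hw : σ z w' = -σ z x' := by
    have h := congrArg (σ z) hq
    rwa [map_zero, map_add, map_add, hC hz' z hz, zero_add, ← eq_neg_iff_add_eq_zero] at h
  change σ (x + x') (y + 0) + σ (z + z') (0 + w') = σ x y + σ z 0 + (σ x' 0 + σ z' w')
  simp only [add_zero, zero_add, map_add, LinearMap.add_apply, map_zero, hy, hw, ← hσ.neg_eq x' z]
  ring

theorem polar_quadrilateralArea_of_mem_inf (hA : A ≤ σ.orthogonal A)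
    (hC : C ≤ σ.orthogonal C) {u : E} (hu : u ∈ A ⊓ C)
    (hflat : (u, 0, -u, 0) ∈ quadrilaterals A B C D)
    {x y z w : E} (h : (x, y, z, w) ∈ quadrilaterals A B C D) :
    polar (quadrilateralArea σ A B C D) ⟨_, hflat⟩ ⟨_, h⟩ = 2 * σ u y := by
  obtain ⟨⟨hx, -, hz, -⟩, hsum⟩ := mem_quadrilaterals.1 h
  have hw : σ u y + σ u w = 0 := by
    have h := congrArg (σ u) hsum
    simpa only [map_add, map_zero, (hA hx) u hu.1, (hC hz) u hu.2, zero_add] using h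
  change σ (u + x) (0 + y) + σ (-u + z) (0 + w) - (σ u 0 + σ (-u) 0) - (σ x y + σ z w) = _
  simp only [zero_add, map_add, map_neg, map_zero, LinearMap.add_apply, LinearMap.neg_apply]
  linear_combination -hw

end Areas

section Cutting

variable {𝕜 E : Type*} [Field 𝕜] [LinearOrder 𝕜] [AddCommGroup E] [Module 𝕜 E]
  [FiniteDimensional 𝕜 E] {σ : LinearMap.BilinForm 𝕜 E}

theorem signature_triangleArea_rotate (hσ : σ.IsAlt) (A B C : Submodule 𝕜 E) :
    signature (triangleArea σ A B C) = signature (triangleArea σ B C A) := by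
  let rotate : triangleArea σ A B C →qᵢ triangleArea σ B C A :=
    { toFun := fun p => ⟨(p.1.2.1, p.1.2.2, p.1.1), mem_triangles.2
        ⟨⟨p.2.1.2.1, p.2.1.2.2, p.2.1.1⟩, by
          rw [← add_assoc, add_comm]
          exact (mem_triangles.1 p.2).2⟩⟩
      map_add' := fun _ _ => rfl
      map_smul' := fun _ _ => rfl
      map_app' := by
        rintro ⟨⟨x, y, z⟩, -, hsum⟩
        change x + (y + z) = 0 at hsum
        change σ y z = σ x y
        rw [eq_neg_of_add_eq_zero_left hsum, map_neg, map_add, LinearMap.neg_apply,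
          LinearMap.add_apply, hσ.self_eq_zero, zero_add, hσ.neg_eq] }
  refine signature_eq_of_surjective rotate fun ⟨⟨y, z, x⟩, ⟨hy, hz, hx⟩, hsum⟩ => ?_
  refine ⟨⟨(x, y, z), mem_triangles.2 ⟨⟨hx, hy, hz⟩, ?_⟩⟩, rfl⟩
  rw [add_comm, add_assoc]
  exact hsum

theorem signature_quadrilateralArea_rotate (hσ : σ.IsAlt) (A B C D : Submodule 𝕜 E) :
    signature (quadrilateralArea σ A B C D) = signature (quadrilateralArea σ B C D A) := by
  let rotate : quadrilateralArea σ A B C D →qᵢ quadrilateralArea σ B C D A :=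
    { toFun := fun p => ⟨(p.1.2.1, p.1.2.2.1, p.1.2.2.2, p.1.1), mem_quadrilaterals.2
        ⟨⟨p.2.1.2.1, p.2.1.2.2.1, p.2.1.2.2.2, p.2.1.1⟩, by
          rw [← add_assoc, ← add_assoc, add_comm, add_assoc]
          exact (mem_quadrilaterals.1 p.2).2⟩⟩
      map_add' := fun _ _ => rfl
      map_smul' := fun _ _ => rfl
      map_app' := by
        rintro ⟨⟨x, y, z, w⟩, -, hsum⟩
        change x + (y + (z + w)) = 0 at hsum
        change σ y z + σ w x = σ x y + σ z w
        rw [eq_neg_of_add_eq_zero_left hsum]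
        simp only [map_neg, map_add, LinearMap.neg_apply, LinearMap.add_apply, hσ.self_eq_zero,
          ← hσ.neg_eq y z, ← hσ.neg_eq z w]
        ring }
  refine signature_eq_of_surjective rotate fun ⟨⟨y, z, w, x⟩, ⟨hy, hz, hw, hx⟩, hsum⟩ => ?_
  refine ⟨⟨(x, y, z, w), mem_quadrilaterals.2 ⟨⟨hx, hy, hz, hw⟩, ?_⟩⟩, rfl⟩
  rw [add_comm, add_assoc, add_assoc]
  exact hsum

variable [IsStrictOrderedRing 𝕜]

theorem signature_triangleArea_add {A C : Submodule 𝕜 E} (hσ : σ.IsAlt)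
    (hA : A ≤ σ.orthogonal A) (hC : C ≤ σ.orthogonal C) (hAC : σ.orthogonal (A ⊓ C) ≤ A ⊔ C)
    (B D : Submodule 𝕜 E) :
    signature (triangleArea σ A B C) + signature (triangleArea σ C D A) =
      signature (quadrilateralArea σ A B C D) := by
  refine signature_add_signature_of_orthogonal_range_sup_le (leftHalf σ A B C D)
    (rightHalf σ A B C D) (isOrtho_leftHalf_rightHalf hσ hA hC) ?_
  rintro ⟨⟨x, y, z, w⟩, h⟩ horth
  refine mem_range_leftHalf_sup_range_rightHalf σ h (hAC fun u hu => ?_)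
  have htriangle : (u, 0, -u) ∈ triangles A B C :=
    mem_triangles.2 ⟨⟨hu.1, zero_mem B, neg_mem hu.2⟩, by abel⟩
  have hpolar := polar_quadrilateralArea_of_mem_inf hA hC hu
    (leftHalf σ A B C D ⟨_, htriangle⟩).2 h
  have hzero := horth _ (Submodule.mem_sup_left ⟨⟨_, htriangle⟩, rfl⟩)
  exact (mul_eq_zero_iff_left two_ne_zero).1 (hpolar.symm.trans hzero)

theorem signature_triangleArea_cocycle (hσ : σ.IsAlt) (hσ' : σ.Nondegenerate)
    {A B C D : Submodule 𝕜 E} (hA : σ.orthogonal A = A) (hB : σ.orthogonal B = B)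
    (hC : σ.orthogonal C = C) (hD : σ.orthogonal D = D) :
    signature (triangleArea σ A B C) + signature (triangleArea σ C D A) =
      signature (triangleArea σ B C D) + signature (triangleArea σ D A B) := by
  have hcut {L M : Submodule 𝕜 E} (hL : σ.orthogonal L = L) (hM : σ.orthogonal M = M) :
      σ.orthogonal (L ⊓ M) ≤ L ⊔ M := by
    rw [orthogonal_inf hσ' hσ.isRefl, hL, hM]
  rw [signature_triangleArea_add hσ hA.ge hC.ge (hcut hA hC),
    signature_triangleArea_add hσ hB.ge hD.ge (hcut hB hD), signature_quadrilateralArea_rotate hσ]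

end Cutting

end Polygons

theorem iSup_add_coe {ι : Sort*} (f : ι → EReal) (c : ℝ) :
    ⨆ i, (f i + c) = (⨆ i, f i) + c := by
  refine eq_of_forall_ge_iff fun y => ?_
  simp only [iSup_le_iff, ← EReal.le_sub_iff_add_le (Or.inl (EReal.coe_ne_bot c))
    (Or.inl (EReal.coe_ne_top c))]

section MaslovIndex

variable {V : Type*} [AddCommGroup V] [Module ℝ V] {σ : LinearMap.BilinForm ℝ V}

theorem finrank_tripleInter (a b c : LagrangianPlane σ) :
    finrank ℝ (tripleInter a c b) = finrank ℝ ↥(a.carrier ⊓ b.carrier ⊓ c.carrier) := by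
  have hle : a.carrier ⊓ c.carrier ⊓ b.carrier ≤ formSpace a c b :=
    fun x hx => ⟨Submodule.mem_sup_left hx.1.1, hx.1.2⟩
  rw [inf_right_comm]
  exact (Submodule.comapSubtypeEquivOfLe hle).finrank_eq

variable [FiniteDimensional ℝ V]

theorem orthogonal_carrier (hσ : σ.Nondegenerate) (a : LagrangianPlane σ) :
    σ.orthogonal a.carrier = a.carrier := by
  have hle : a.carrier ≤ σ.orthogonal a.carrier := fun x hx y hy => a.isotropic y hy x hx
  refine (Submodule.eq_of_le_of_finrank_le hle ?_).symm
  have hdim := a.two_mul_finrank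
  rw [LinearMap.BilinForm.finrank_orthogonal hσ]
  lia

/-- The Kashiwara index of three Lagrangian planes. -/
noncomputable def tripleIndex (a b c : LagrangianPlane σ) : ℤ :=
  signature (triangleArea σ a.carrier b.carrier c.carrier)

theorem tripleIndex_rotate (hσ : σ.IsAlt) (a b c : LagrangianPlane σ) :
    tripleIndex a b c = tripleIndex b c a :=
  signature_triangleArea_rotate hσ _ _ _

theorem tripleIndex_cocycle (hσ : IsSymplectic σ) (a b c d : LagrangianPlane σ) :
    tripleIndex a b c + tripleIndex c d a = tripleIndex b c d + tripleIndex d a b :=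
  signature_triangleArea_cocycle hσ.alt hσ.nondegenerate
    (orthogonal_carrier hσ.nondegenerate a) (orthogonal_carrier hσ.nondegenerate b)
    (orthogonal_carrier hσ.nondegenerate c) (orthogonal_carrier hσ.nondegenerate d)

theorem signature_form (a b c : LagrangianPlane σ) :
    signature (form a c b) = tripleIndex a b c := by
  let diagonal : triangles a.carrier b.carrier c.carrier →ₗ[ℝ] formSpace a c b :=
    { toFun := fun p => ⟨p.1.1 + p.1.2.1, Submodule.add_mem_sup p.2.1.1 p.2.1.2.1, by
        rw [eq_neg_of_add_eq_zero_left
          ((add_assoc _ _ _).trans (mem_triangles.1 p.2).2)]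
        exact neg_mem p.2.1.2.2⟩
      map_add' := fun p q => Subtype.ext (add_add_add_comm _ _ _ _)
      map_smul' := fun r p => Subtype.ext (smul_add r _ _).symm }
  let diagonalClass : triangleArea σ a.carrier b.carrier c.carrier →qᵢ form a c b :=
    ⟨(tripleInter a c b).mkQ ∘ₗ diagonal, fun p =>
      preForm_eq a c b (diagonal p) p.2.1.1 p.2.1.2.1 rfl⟩
  refine (signature_eq_of_surjective diagonalClass
    ((Submodule.mkQ_surjective _).comp fun ⟨z, hz, hzc⟩ => ?_)).symm
  obtain ⟨x, hx, y, hy, rfl⟩ := Submodule.mem_sup.1 hz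
  exact ⟨⟨(x, y, -(x + y)), mem_triangles.2 ⟨⟨hx, hy, neg_mem hzc⟩, by abel⟩⟩, rfl⟩

theorem formSpace_eq_orthogonal (hσ : IsSymplectic σ) (a b c : LagrangianPlane σ) :
    formSpace a c b = σ.orthogonal (a.carrier ⊓ b.carrier ⊔ c.carrier) := by
  rw [orthogonal_sup, orthogonal_inf hσ.nondegenerate hσ.alt.isRefl, formSpace,
    orthogonal_carrier hσ.nondegenerate, orthogonal_carrier hσ.nondegenerate,
    orthogonal_carrier hσ.nondegenerate]

theorem two_mul_finrank_quotient_tripleInter_add (hσ : IsSymplectic σ)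
    (a b c : LagrangianPlane σ) :
    2 * (finrank ℝ (formSpace a c b ⧸ tripleInter a c b) +
      finrank ℝ ↥(a.carrier ⊓ b.carrier)) = finrank ℝ V := by
  have hquot := Submodule.finrank_quotient_add_finrank (tripleInter a c b)
  have hsum := Submodule.finrank_sup_add_finrank_inf_eq (a.carrier ⊓ b.carrier) c.carrier
  have hsup := (a.carrier ⊓ b.carrier ⊔ c.carrier).finrank_le
  have horth := LinearMap.BilinForm.finrank_orthogonal hσ.nondegenerate
    (a.carrier ⊓ b.carrier ⊔ c.carrier)
  have hc := c.two_mul_finrank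
  rw [← formSpace_eq_orthogonal hσ] at horth
  rw [finrank_tripleInter] at hquot
  lia

theorem posMaslovIndex_eq (hσ : IsSymplectic σ) (Γ a b : LagrangianPlane σ) :
    posMaslovIndex Γ a b = (tripleIndex a b Γ : ℝ) / 2 + (finrank ℝ V : ℝ) / 4 -
      (finrank ℝ ↥(a.carrier ⊓ b.carrier) : ℝ) / 2 := by
  have hinertia := sigPos_add_sigNeg_add_radical (Q := form a Γ b)
  have hdim := two_mul_finrank_quotient_tripleInter_add hσ a b Γ
  have hsign : (tripleIndex a b Γ : ℝ) = sigPos (form a Γ b) - sigNeg (form a Γ b) := by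
    rw [← signature_form, signature]
    push_cast
    rfl
  rw [← hinertia] at hdim
  rify at hdim
  rw [posMaslovIndex, hsign]
  linarith

theorem posMaslovIndex_sub (hσ : IsSymplectic σ) (Γ Δ a b : LagrangianPlane σ) :
    posMaslovIndex Γ a b - posMaslovIndex Δ a b =
      (tripleIndex b Γ Δ : ℝ) / 2 - (tripleIndex a Γ Δ : ℝ) / 2 := by
  have hcocycle := tripleIndex_cocycle hσ a b Γ Δ
  rw [← tripleIndex_rotate hσ.alt a Γ Δ, tripleIndex_rotate hσ.alt Δ a b] at hcocycle
  rify at hcocycle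
  rw [posMaslovIndex_eq hσ, posMaslovIndex_eq hσ]
  linarith

theorem partitionIndex_eq_add (hσ : IsSymplectic σ) {T : ℝ}
    (Λ : Set.Icc (0 : ℝ) T → LagrangianPlane σ) (D : IntervalPartition T)
    (Γ Δ : LagrangianPlane σ) :
    partitionIndex Γ Λ D = partitionIndex Δ Λ D +
      ((tripleIndex (Λ (D.t (Fin.last D.N))) Γ Δ : ℝ) / 2 -
        (tripleIndex (Λ (D.t 0)) Γ Δ : ℝ) / 2) := by
  rw [← sub_eq_iff_eq_add', partitionIndex, partitionIndex, ← Finset.sum_sub_distrib]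
  simp only [posMaslovIndex_sub hσ, Finset.sum_sub_distrib]
  let τ : Fin (D.N + 1) → ℝ := fun i => (tripleIndex (Λ (D.t i)) Γ Δ : ℝ) / 2
  change ∑ i : Fin D.N, τ i.succ - ∑ i : Fin D.N, τ i.castSucc = τ (Fin.last D.N) - τ 0
  have hsucc := Fin.sum_univ_succ τ
  have hcastSucc := Fin.sum_univ_castSucc τ
  linarith

end MaslovIndex

end Symp

theorem mainTheorem9_general {V : Type*} [AddCommGroup V] [Module ℝ V] [FiniteDimensional ℝ V]
    (σ : LinearMap.BilinForm ℝ V) (hσ : Symp.IsSymplectic σ)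
    (T : ℝ) (hT : 0 ≤ T) (Λ : Set.Icc (0 : ℝ) T → Symp.LagrangianPlane σ)
    (Γ Δ : Symp.LagrangianPlane σ) :
    Symp.curveIndex Γ Λ = Symp.curveIndex Δ Λ +
      (((Symp.tripleIndex (Λ ⟨T, Set.right_mem_Icc.2 hT⟩) Γ Δ : ℝ) / 2 -
        (Symp.tripleIndex (Λ ⟨0, Set.left_mem_Icc.2 hT⟩) Γ Δ : ℝ) / 2 : ℝ) : EReal) := by
  have hfirst (D : Symp.IntervalPartition T) : D.t 0 = ⟨0, Set.left_mem_Icc.2 hT⟩ :=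
    Subtype.ext D.first
  have hlast (D : Symp.IntervalPartition T) :
      D.t (Fin.last D.N) = ⟨T, Set.right_mem_Icc.2 hT⟩ :=
    Subtype.ext D.last
  rw [Symp.curveIndex, Symp.curveIndex, ← Symp.iSup_add_coe]
  refine iSup_congr fun D => ?_
  rw [Symp.partitionIndex_eq_add hσ Λ D Γ Δ, hfirst, hlast, EReal.coe_add]

theorem mainTheorem9 {V : Type*} [AddCommGroup V] [Module ℝ V] [FiniteDimensional ℝ V]
    (σ : LinearMap.BilinForm ℝ V) (hσ : Symp.IsSymplectic σ)
    (T : ℝ) (hT : 0 < T) (Λ : Set.Icc (0 : ℝ) T → Symp.LagrangianPlane σ)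
    (hclosed : Λ ⟨0, Set.left_mem_Icc.2 hT.le⟩ = Λ ⟨T, Set.right_mem_Icc.2 hT.le⟩)
    (hmono : Symp.IsMonotoneIncreasing Λ) (Γ Δ : Symp.LagrangianPlane σ) :
    Symp.curveIndex Γ Λ = Symp.curveIndex Δ Λ := by
  rw [mainTheorem9_general σ hσ T hT.le Λ Γ Δ, hclosed, sub_self, EReal.coe_zero, add_zero]
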